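/- Let $d\ge 1$ be an integer, let $\|\cdot\|$ be the Euclidean norm on $\mathbb R^d$, and let $\alpha\in(1,2)$. Let $$\nu_\alpha(du)=\frac{c_{\alpha,d}}{\|u\|^{d+\alpha}}\,du,\qquad c_{\alpha,d}=\frac{-\alpha(\alpha-1)\,\Gamma((\alpha+d)/2)}{4\cos(\alpha\pi/2)\,\Gamma((\alpha+1)/2)\,\pi^{(d-1)/2}\,\Gamma(2-\alpha)},$$ and let $\mu_\alpha$ be the associated centered rotationally invariant $\alpha$-stable law, i.e. the infinitely divisible law with triplet $\left(-\int_{\|u\|>1}u\,\nu_\alpha(du),\,0,\,\nu_\alpha\right)$ (truncation on the closed unit ball), whose characteristic function is $\exp(-\|\xi\|^\alpha/2)$. For probability measures $\mu_1,\mu_2$ on $\mathbb R^d$ let $$d_{W_1}(\mu_1,\mu_2)=\sup_h\left|\int h\,d\mu_1-\int h\,d\mu_2\right|,$$ the supremum being over the continuously differentiable $h:\mathbb R^d\to\mathbb R$ with $|h(x)|\le 1$ and $\|\nabla h(x)\|\le 1$ for all $x$. There is a constant $C_{\alpha,d}>0$, depending only on $\alpha$ and $d$, such that the following holds. Let $\beta\in(1,\alpha)$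 and let $\mu$ be a probability measure on $\mathbb R^d$ with $\int\|x\|^\beta\mu(dx)<\infty$, $\int x\,\mu(dx)=0$ and $\mu*\nu_\alpha\ll\mu$. Let $$\mathcal E_\mu(f,g)=\int_{\mathbb R^d}\int_{\mathbb R^d}(f(x+u)-f(x))(g(x+u)-g(x))\,\nu_\alpha(du)\,\mu(dx)$$ and let $\mathcal D(\mathcal E_\mu)\subset L^2(\mu)$ be the domain of the smallest closed extension in $L^2(\mu)$ of the form $\mathcal E_\mu$ on the Schwartz space $\mathcal S(\mathbb R^d)$. Let $U_\mu>0$ be such that * for all $f\in\mathcal D(\mathcal E_\mu)$ with $\int f\,d\mu=0$, $$\int_{\mathbb R^d}|f(x)|^2\mu(dx)\le U_\mu\int_{\mathbb R^d}\int_{\mathbb R^d}|f(x+u)-f(x)|^2\nu_\alpha(du)\,\mu(dx);$$ * for every $j\in\{1,\dots,d\}$, with $\psi(x)=\exp(-\|x\|^2)$ and $\tilde g_{R,j}(x)=x_j\psi(x/R)-\int y_j\psi(y/R)\,\mu(dy)$, $$\lim_{R\to+\infty}\left(\mathcal E_\mu(U_\mu\tilde g_{R,j},\tilde g_{R,j})-\langle\tilde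 g_{R,j};\tilde g_{R,j}\rangle_{L^2(\mu)}\right)=0.$$ Then $$d_{W_1}(\mu,\mu_\alpha)\le C_{\alpha,d}\left(\int_{\|u\|\le1}\|u\|^2\nu_\alpha(du)+\int_{\|u\|\ge1}\|u\|\,\nu_\alpha(du)\right)|U_\mu-1|.$$ -/

import Mathlib

open MeasureTheory Filter Topology
open scoped SchwartzMap

namespace StableStability

/-- The Euclidean space `ℝᵈ`. -/
abbrev Rd (d : ℕ) : Type := EuclideanSpace ℝ (Fin d)

/-! ### The rotationally invariant stable law -/

/-- The normalising constant `c_{α,d}` of the Lévy measure of the rotationally invariant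
`α`-stable law with characteristic function `exp (-‖ξ‖ ^ α / 2)` on `ℝᵈ`. -/
noncomputable def stableConst (α : ℝ) (d : ℕ) : ℝ :=
  (-α * (α - 1) * Real.Gamma ((α + d) / 2)) /
    (4 * Real.cos (α * Real.pi / 2) * Real.Gamma ((α + 1) / 2) *
      Real.pi ^ (((d : ℝ) - 1) / 2) * Real.Gamma (2 - α))

/-- The Lévy measure `ν_α(du) = c_{α,d} ‖u‖ ^ (-(d + α)) du`; in polar coordinates,
`c_{α,d} r ^ (-(α + 1)) dr σ(dx)` with `σ` the surface measure of the unit sphere. -/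
noncomputable def stableLevyMeasure (α : ℝ) (d : ℕ) : Measure (Rd d) :=
  volume.withDensity fun u => ENNReal.ofReal (stableConst α d / ‖u‖ ^ ((d : ℝ) + α))

/-- `ν` is a Lévy measure: `ν {0} = 0` and `∫ (1 ∧ ‖u‖²) ν(du) < ∞`. -/
def IsLevyMeasure {d : ℕ} (ν : Measure (Rd d)) : Prop :=
  ν {0} = 0 ∧ ∫⁻ u, ENNReal.ofReal (min 1 (‖u‖ ^ 2)) ∂ν < ⊤

/-- `μ` is infinitely divisible with triplet `(b, S, ν)` (Lévy–Khintchine representation with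
truncation on the closed unit ball). -/
def IsInfDivWithTriplet {d : ℕ} (b : Rd d) (S : Matrix (Fin d) (Fin d) ℝ)
    (ν : Measure (Rd d)) (μ : Measure (Rd d)) : Prop :=
  IsProbabilityMeasure μ ∧ S.PosSemidef ∧ IsLevyMeasure ν ∧
    ∀ ξ : Rd d, charFun μ ξ =
      Complex.exp (Complex.I * ((inner ℝ b ξ : ℝ) : ℂ)
        - (1 / 2 : ℂ) * ((∑ i, ∑ j, ξ i * S i j * ξ j : ℝ) : ℂ)
        + ∫ u, (Complex.exp (Complex.I * ((inner ℝ ξ u : ℝ) : ℂ)) - 1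
            - Complex.I * (((Metric.closedBall (0 : Rd d) 1).indicator
                (fun u => (inner ℝ ξ u : ℝ)) u : ℝ) : ℂ)) ∂ν)

/-- `μ` is the (centered) rotationally invariant `α`-stable law with Lévy measure `ν_α`, i.e.
the infinitely divisible law with triplet `(-∫_{‖u‖ > 1} u ν_α(du), 0, ν_α)`. -/
def IsStableLaw (α : ℝ) (d : ℕ) (μ : Measure (Rd d)) : Prop :=
  IsInfDivWithTriplet (-∫ u in {u : Rd d | 1 < ‖u‖}, u ∂(stableLevyMeasure α d)) 0
    (stableLevyMeasure α d) μ

/-! ### The smooth Wasserstein distances -/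

/-- The class `H_r` of `r` times continuously differentiable functions all of whose derivatives
of order `0 ≤ ℓ ≤ r` are bounded by `1` in operator norm. -/
def smoothTestClass (d r : ℕ) : Set (Rd d → ℝ) :=
  {h | ContDiff ℝ r h ∧ ∀ l ≤ r, ∀ x, ‖iteratedFDeriv ℝ l h x‖ ≤ 1}

/-- The smooth Wasserstein distance `d_{W_r}` of order `r` between two probability measures. -/
noncomputable def smoothWasserstein {d : ℕ} (r : ℕ) (μ₁ μ₂ : Measure (Rd d)) : ℝ :=
  sSup {t : ℝ | ∃ h ∈ smoothTestClass d r, t = |(∫ x, h x ∂μ₁) - ∫ x, h x ∂μ₂|}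

/-! ### The non-local form -/

/-- The form `(f, g) ↦ ∫ ∫ (f(x+u) - f(x)) (g(x+u) - g(x)) ν(du) μ(dx)`. -/
noncomputable def nonlocalForm {d : ℕ} (ν μ : Measure (Rd d)) (f g : Rd d → ℝ) : ℝ :=
  ∫ x, ∫ u, (f (x + u) - f x) * (g (x + u) - g x) ∂ν ∂μ

/-- The domain of the smallest closed extension in `L²(μ)` of the form `nonlocalForm ν μ` on
Schwartz functions: the `f ∈ L²(μ)` that are `L²(μ)`-limits of sequences of Schwartz functions
which are Cauchy for the form. When `μ ∗ ν ≪ μ`, the extended form is again given on this domain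
by the double integral. -/
def InFormDomain {d : ℕ} (ν μ : Measure (Rd d)) (f : Rd d → ℝ) : Prop :=
  MemLp f 2 μ ∧ ∃ φ : ℕ → 𝓢(Rd d, ℝ),
    Tendsto (fun n => eLpNorm (fun x => φ n x - f x) 2 μ) atTop (𝓝 0) ∧
    Tendsto (fun p : ℕ × ℕ => nonlocalForm ν μ (fun x => φ p.1 x - φ p.2 x)
      (fun x => φ p.1 x - φ p.2 x)) atTop (𝓝 0)

/-- The non-local Poincaré inequality with constant `U` on the domain of the closed form. -/
def NonlocalPoincare {d : ℕ} (ν μ : Measure (Rd d)) (U : ℝ) : Prop :=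
  ∀ f : Rd d → ℝ, InFormDomain ν μ f → ∫ x, f x ∂μ = 0 →
    ∫ x, |f x| ^ 2 ∂μ ≤ U * ∫ x, ∫ u, |f (x + u) - f x| ^ 2 ∂ν ∂μ

/-- The truncated coordinate `x_j ψ(x/R)`, with `ψ(x) = exp (-‖x‖²)`. -/
noncomputable def truncCoord {d : ℕ} (R : ℝ) (j : Fin d) (x : Rd d) : ℝ :=
  x j * Real.exp (-‖R⁻¹ • x‖ ^ 2)

/-- The truncated coordinate, centered with respect to `μ`. -/
noncomputable def centeredTruncCoord {d : ℕ} (μ : Measure (Rd d)) (R : ℝ) (j : Fin d)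
    (x : Rd d) : ℝ :=
  truncCoord R j x - ∫ y, truncCoord R j y ∂μ

/-- The Weyl-type condition: for each `j`, with `g̃` the centered truncated coordinate,
`E(U g̃, g̃) - ⟨g̃, g̃⟩_{L²(μ)} → 0` as `R → ∞`. -/
def WeylCondition {d : ℕ} (ν μ : Measure (Rd d)) (U : ℝ) : Prop :=
  ∀ j : Fin d, Tendsto (fun R : ℝ =>
    nonlocalForm ν μ (fun x => U * centeredTruncCoord μ R j x) (centeredTruncCoord μ R j)
      - ∫ x, centeredTruncCoord μ R j x * centeredTruncCoord μ R j x ∂μ) atTop (𝓝 0)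

end StableStability

namespace StableStability

open scoped ContDiff

variable {d : ℕ}

/-! The hypotheses force `μ` to be a dilation of the stable law, and the estimate compares a law
with its own dilation.

The Poincaré inequality says that `U * nonlocalForm` minus the covariance is a nonnegative quadratic
form. The Weyl condition says that this form tends to zero along the truncated coordinates. By
Cauchy–Schwarz (`NonlocalPoincare.cauchy_schwarz`) its pairing with any fixed smooth bounded
Lipschitz `f` also tends to zero. Letting `R → ∞` gives the Stein identity `U ∫∫ u_j (f(x+u) - f(x))
dν dμ = ∫ x_j f dμ` (`stein_identity_coord`).

For `f` the real and imaginary parts of a character, the identity becomes a linear differential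
equation for `t ↦ charFun μ (t • ξ)`, solved by `exp (U * levyExponent)`
(`charFun_eq_exp_levyExponent`). The exponent is homogeneous of degree `α` (`levyExponent_smul`), so
`μ` is the law of `U^(1/α) X` with `X` stable (`IsStableLaw.eq_map_smul`). A test function is
1-Lipschitz, hence the distance is at most `|U^(1/α) - 1| E‖X‖ ≤ |U - 1| E‖X‖`. -/

/-! ### Integrals of increments -/

/-- The weight `‖u‖ (1 ∧ ‖u‖)`, which dominates the products of increments in the form. -/
noncomputable def levyWeight (u : Rd d) : ℝ := ‖u‖ * min 1 ‖u‖

lemma levyWeight_nonneg (u : Rd d) : 0 ≤ levyWeight u :=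
  mul_nonneg (norm_nonneg u) (le_min zero_le_one (norm_nonneg u))

/-- A double dominated convergence theorem. -/
lemma tendsto_integral_integral_of_dominated {ι : Type*} {l : Filter ι} [l.IsCountablyGenerated]
    {ν μ : Measure (Rd d)} [SFinite ν] [IsFiniteMeasure μ] {F : ι → Rd d → Rd d → ℝ}
    {G : Rd d → Rd d → ℝ} {k : Rd d → ℝ} (hk : Integrable k ν)
    (hF : ∀ i, Continuous fun p : Rd d × Rd d => F i p.1 p.2)
    (hb : ∀ i x u, |F i x u| ≤ k u)
    (hlim : ∀ x u, Tendsto (fun i => F i x u) l (𝓝 (G x u))) :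
    Tendsto (fun i => ∫ x, ∫ u, F i x u ∂ν ∂μ) l (𝓝 (∫ x, ∫ u, G x u ∂ν ∂μ)) := by
  refine tendsto_integral_filter_of_dominated_convergence (fun _ => ∫ u, k u ∂ν) ?_ ?_
    (integrable_const _) ?_
  · exact Eventually.of_forall fun i =>
      ((hF i).stronglyMeasurable.integral_prod_right').aestronglyMeasurable
  · refine Eventually.of_forall fun i => Eventually.of_forall fun x => ?_
    exact norm_integral_le_of_norm_le hk (Eventually.of_forall fun u => hb i x u)
  · refine Eventually.of_forall fun x => ?_
    refine tendsto_integral_filter_of_dominated_convergence k ?_ ?_ hk ?_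
    · exact Eventually.of_forall fun i =>
        ((hF i).comp (Continuous.prodMk_right x)).aestronglyMeasurable
    · exact Eventually.of_forall fun i => Eventually.of_forall fun u => hb i x u
    · exact Eventually.of_forall fun u => hlim x u

/-- Bounded Lipschitz functions with a common constant. -/
structure BoundedLip (C : ℝ) (f : Rd d → ℝ) : Prop where
  bound : ∀ x, |f x| ≤ C
  lip : ∀ x y, |f x - f y| ≤ C * ‖x - y‖

namespace BoundedLip

variable {C D : ℝ} {f g : Rd d → ℝ}

lemma const_nonneg (hf : BoundedLip C f) : 0 ≤ C := (abs_nonneg _).trans (hf.bound 0)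

lemma continuous (hf : BoundedLip C f) : Continuous f := by
  refine (LipschitzWith.of_dist_le_mul (K := ⟨C, hf.const_nonneg⟩) fun x y => ?_).continuous
  rw [Real.dist_eq, dist_eq_norm]
  exact hf.lip x y

lemma increment_le (hf : BoundedLip C f) (x u : Rd d) :
    |f (x + u) - f x| ≤ 2 * C * min 1 ‖u‖ := by
  have h0 := hf.const_nonneg
  rw [mul_min_of_nonneg _ _ (by positivity)]
  refine le_min ?_ ?_
  · have := abs_sub (f (x + u)) (f x)
    have := hf.bound (x + u)
    have := hf.bound x
    linarith
  · have := hf.lip (x + u) x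
    rw [add_sub_cancel_left] at this
    nlinarith [mul_nonneg h0 (norm_nonneg u)]

lemma const (c : ℝ) : BoundedLip |c| (fun _ : Rd d => c) :=
  ⟨fun _ => le_rfl, fun x y => by simpa using by positivity⟩

lemma add (hf : BoundedLip C f) (hg : BoundedLip D g) : BoundedLip (C + D) (fun x => f x + g x) :=
  ⟨fun x => (abs_add_le _ _).trans (add_le_add (hf.bound x) (hg.bound x)), fun x y => by
    rw [add_sub_add_comm, add_mul]
    exact (abs_add_le _ _).trans (add_le_add (hf.lip x y) (hg.lip x y))⟩

lemma const_mul (hf : BoundedLip C f) (c : ℝ) : BoundedLip (|c| * C) (fun x => c * f x) :=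
  ⟨fun x => by
    rw [abs_mul]
    exact mul_le_mul_of_nonneg_left (hf.bound x) (abs_nonneg c), fun x y => by
    rw [← mul_sub, abs_mul, mul_assoc]
    exact mul_le_mul_of_nonneg_left (hf.lip x y) (abs_nonneg c)⟩

lemma sub (hf : BoundedLip C f) (hg : BoundedLip D g) : BoundedLip (C + D) (fun x => f x - g x) := by
  simpa [sub_eq_add_neg] using hf.add (hg.const_mul (-1))

lemma mul (hf : BoundedLip C f) (hg : BoundedLip D g) :
    BoundedLip (2 * C * D) (fun x => f x * g x) := by
  have hC := hf.const_nonneg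
  have hD := hg.const_nonneg
  refine ⟨fun x => ?_, fun x y => ?_⟩
  · rw [abs_mul]
    have := mul_le_mul (hf.bound x) (hg.bound x) (abs_nonneg _) hC
    nlinarith [mul_nonneg hC hD]
  · have e : f x * g x - f y * g y = (f x - f y) * g x + f y * (g x - g y) := by ring
    rw [e]
    refine (abs_add_le _ _).trans ?_
    rw [abs_mul, abs_mul]
    have h1 := mul_le_mul (hf.lip x y) (hg.bound x) (abs_nonneg _)
      (mul_nonneg hC (norm_nonneg _))
    have h2 := mul_le_mul (hf.bound y) (hg.lip x y) (abs_nonneg _) hC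
    nlinarith

lemma integrable {μ : Measure (Rd d)} [IsFiniteMeasure μ] (hf : BoundedLip C f) :
    Integrable f μ :=
  Integrable.of_bound hf.continuous.aestronglyMeasurable C (Eventually.of_forall hf.bound)

lemma memLp {μ : Measure (Rd d)} [IsFiniteMeasure μ] (hf : BoundedLip C f) (p : ENNReal) :
    MemLp f p μ :=
  MemLp.of_bound hf.continuous.aestronglyMeasurable C (Eventually.of_forall hf.bound)

/-- Only one factor has to be bounded: the Lipschitz factor supplies `‖u‖`, the bounded one `min 1
‖u‖`. This admits the unbounded coordinate functions, and the bound is uniform in `x`. -/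
lemma increment_mul_le {L : ℝ} (hL : 0 ≤ L) (hg : ∀ x y, |g x - g y| ≤ L * ‖x - y‖)
    (hf : BoundedLip C f) (x u : Rd d) :
    |(g (x + u) - g x) * (f (x + u) - f x)| ≤ 2 * L * C * levyWeight u := by
  rw [abs_mul]
  have h1 := hg (x + u) x
  rw [add_sub_cancel_left] at h1
  refine (mul_le_mul h1 (hf.increment_le x u) (abs_nonneg _)
    (mul_nonneg hL (norm_nonneg _))).trans (le_of_eq ?_)
  unfold levyWeight
  ring

end BoundedLip

/-! ### Bilinearity of the form -/

section Form

variable {ν μ : Measure (Rd d)} {f g h : Rd d → ℝ} {C D : ℝ}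

lemma continuous_increment_mul (hf : Continuous f) (hg : Continuous g) :
    Continuous fun p : Rd d × Rd d => (f (p.1 + p.2) - f p.1) * (g (p.1 + p.2) - g p.1) := by
  fun_prop

lemma integrable_increment_mul (hν : Integrable (levyWeight (d := d)) ν) (hf : BoundedLip C f)
    (hg : BoundedLip D g) (x : Rd d) :
    Integrable (fun u => (f (x + u) - f x) * (g (x + u) - g x)) ν :=
  (hν.const_mul (2 * C * D)).mono'
    ((continuous_increment_mul hf.continuous hg.continuous).comp
      (Continuous.prodMk_right x)).aestronglyMeasurable
    (Eventually.of_forall fun u => BoundedLip.increment_mul_le hf.const_nonneg hf.lip hg x u)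

lemma integrable_integral_increment_mul [SFinite ν] [IsFiniteMeasure μ]
    (hν : Integrable (levyWeight (d := d)) ν)
    (hf : BoundedLip C f) (hg : BoundedLip D g) :
    Integrable (fun x => ∫ u, (f (x + u) - f x) * (g (x + u) - g x) ∂ν) μ := by
  refine Integrable.of_bound (C := ∫ u, 2 * C * D * levyWeight u ∂ν)
    (continuous_increment_mul hf.continuous
      hg.continuous).stronglyMeasurable.integral_prod_right'.aestronglyMeasurable
    (Eventually.of_forall fun x => ?_)
  exact norm_integral_le_of_norm_le (hν.const_mul _) (Eventually.of_forall fun u =>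
    BoundedLip.increment_mul_le hf.const_nonneg hf.lip hg x u)

lemma nonlocalForm_comm (f g : Rd d → ℝ) : nonlocalForm ν μ f g = nonlocalForm ν μ g f := by
  simp only [nonlocalForm, mul_comm]

lemma nonlocalForm_const_mul_left (c : ℝ) (f g : Rd d → ℝ) :
    nonlocalForm ν μ (fun x => c * f x) g = c * nonlocalForm ν μ f g := by
  simp only [nonlocalForm, ← mul_sub, mul_assoc, integral_const_mul]

lemma nonlocalForm_add_left [SFinite ν] [IsFiniteMeasure μ] {D' : ℝ}
    (hν : Integrable (levyWeight (d := d)) ν)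
    (hf : BoundedLip C f) (hg : BoundedLip D g) (hh : BoundedLip D' h) :
    nonlocalForm ν μ (fun x => f x + g x) h = nonlocalForm ν μ f h + nonlocalForm ν μ g h := by
  unfold nonlocalForm
  rw [← integral_add (integrable_integral_increment_mul hν hf hh)
    (integrable_integral_increment_mul hν hg hh)]
  refine integral_congr_ae (Eventually.of_forall fun x => ?_)
  dsimp only
  rw [← integral_add (integrable_increment_mul hν hf hh x) (integrable_increment_mul hν hg hh x)]
  refine integral_congr_ae (Eventually.of_forall fun u => ?_)
  dsimp only
  ring

lemma nonlocalForm_sub_const (c : ℝ) (f g : Rd d → ℝ) :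
    nonlocalForm ν μ (fun x => f x - c) g = nonlocalForm ν μ f g := by
  simp only [nonlocalForm, sub_sub_sub_cancel_right]

lemma nonlocalForm_self_mul_add [SFinite ν] [IsFiniteMeasure μ]
    (hν : Integrable (levyWeight (d := d)) ν)
    (hf : BoundedLip C f) (hg : BoundedLip D g) (s : ℝ) :
    nonlocalForm ν μ (fun x => s * f x + g x) (fun x => s * f x + g x) =
      s ^ 2 * nonlocalForm ν μ f f + 2 * s * nonlocalForm ν μ f g + nonlocalForm ν μ g g := by
  have hs := hf.const_mul s
  rw [nonlocalForm_add_left hν hs hg (hs.add hg),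
    nonlocalForm_comm (fun x => s * f x) fun x => s * f x + g x,
    nonlocalForm_comm g fun x => s * f x + g x,
    nonlocalForm_add_left hν hs hg hs, nonlocalForm_add_left hν hs hg hg,
    nonlocalForm_const_mul_left, nonlocalForm_const_mul_left,
    nonlocalForm_comm f (fun x => s * f x), nonlocalForm_comm g (fun x => s * f x),
    nonlocalForm_const_mul_left, nonlocalForm_const_mul_left]
  ring

end Form

/-! ### Smooth bounded Lipschitz functions belong to the form domain -/

/-- Smooth cut-off functions, equal to one on balls of radius tending to infinity, with a common
bound and Lipschitz constant. -/
lemma exists_cutoff (d : ℕ) : ∃ (K : ℝ) (χ : ℕ → Rd d → ℝ), (∀ n, BoundedLip K (χ n)) ∧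
    (∀ n, ContDiff ℝ ∞ (χ n)) ∧ (∀ n, HasCompactSupport (χ n)) ∧
    ∀ x, Tendsto (fun n => χ n x) atTop (𝓝 1) := by
  let b : ContDiffBump (0 : Rd d) := ⟨1, 2, one_pos, one_lt_two⟩
  obtain ⟨K, hK⟩ := (b.contDiff (n := 1)).lipschitzWith_of_hasCompactSupport b.hasCompactSupport
    one_ne_zero
  have hpos : ∀ n : ℕ, (0 : ℝ) < n + 1 := fun n => by positivity
  refine ⟨max 1 K, fun n x => b (((n : ℝ) + 1)⁻¹ • x), fun n => ⟨fun x => ?_, fun x y => ?_⟩,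
    fun n => ?_, fun n => ?_, fun x => ?_⟩
  · rw [abs_of_nonneg b.nonneg]
    exact b.le_one.trans (le_max_left _ _)
  · have h := hK.dist_le_mul (((n : ℝ) + 1)⁻¹ • x) (((n : ℝ) + 1)⁻¹ • y)
    rw [Real.dist_eq, dist_eq_norm, ← smul_sub, norm_smul, Real.norm_of_nonneg
      (inv_nonneg.2 (hpos n).le)] at h
    -- Dilating the bump by a factor at least one does not increase its Lipschitz constant, so one
    -- `K` serves all `n`.
    have h1 : ((n : ℝ) + 1)⁻¹ ≤ 1 := inv_le_one_of_one_le₀ (by simp)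
    refine h.trans (mul_le_mul (le_max_right _ _) ?_ (by have := hpos n; positivity) (by positivity))
    exact mul_le_of_le_one_left (norm_nonneg _) h1
  · exact b.contDiff.comp (contDiff_const_smul _)
  · exact b.hasCompactSupport.comp_smul (inv_ne_zero (hpos n).ne')
  · refine tendsto_const_nhds.congr' ?_
    filter_upwards [eventually_ge_atTop ⌈‖x‖⌉₊] with n hn
    symm
    refine b.one_of_mem_closedBall ?_
    rw [mem_closedBall_zero_iff, norm_smul, Real.norm_of_nonneg (inv_nonneg.2 (hpos n).le)]
    change _ ≤ (1 : ℝ)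
    rw [inv_mul_le_iff₀ (hpos n), mul_one]
    have := (Nat.le_ceil ‖x‖).trans (Nat.cast_le.2 hn)
    linarith

/-- The products of `f` with the cut-offs are Schwartz, converge pointwise and share one
`BoundedLip` constant, so dominated convergence gives both the `L²` limit and the Cauchy property
for the form. -/
lemma inFormDomain_of_contDiff {ν μ : Measure (Rd d)} [SFinite ν] [IsFiniteMeasure μ]
    (hν : Integrable (levyWeight (d := d)) ν) {f : Rd d → ℝ} {C : ℝ} (hf : BoundedLip C f)
    (hf' : ContDiff ℝ ∞ f) : InFormDomain ν μ f := by
  refine ⟨hf.memLp 2, ?_⟩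
  obtain ⟨K, χ, hχ, hχs, hχc, hχt⟩ := exists_cutoff d
  have hmul : ∀ n, BoundedLip (2 * C * K) (fun x => f x * χ n x) := fun n => hf.mul (hχ n)
  let φ : ℕ → 𝓢(Rd d, ℝ) := fun n =>
    ((hχc n).mul_left (f := f)).toSchwartzMap (hf'.mul (hχs n))
  have hφ : ∀ n x, φ n x = f x * χ n x := fun n x => rfl
  have hlim : ∀ x, Tendsto (fun n => φ n x) atTop (𝓝 (f x)) := fun x => by
    simpa [hφ] using (hχt x).const_mul (f x)
  refine ⟨φ, ?_, ?_⟩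
  · have hb : ∀ n x, ‖φ n x - f x‖ ≤ 2 * C * K + C := fun n x =>
      ((hmul n).sub hf).bound x
    have hm : ∀ n, AEStronglyMeasurable (fun x => φ n x - f x) μ := fun n =>
      ((φ n).continuous.sub hf.continuous).aestronglyMeasurable
    have key : Tendsto (fun n => ∫⁻ x, ‖φ n x - f x‖ₑ ^ (2 : ℝ) ∂μ) atTop (𝓝 0) := by
      have := tendsto_lintegral_filter_of_dominated_convergence (μ := μ) (l := atTop)
        (F := fun n x => ‖φ n x - f x‖ₑ ^ (2 : ℝ)) (f := fun _ => 0)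
        (fun _ => ENNReal.ofReal (2 * C * K + C) ^ (2 : ℝ))
        (Eventually.of_forall fun n => by
          exact ((φ n).continuous.sub hf.continuous).enorm.measurable.pow_const _)
        (Eventually.of_forall fun n => Eventually.of_forall fun x => by
          gcongr
          rw [← ofReal_norm]
          exact ENNReal.ofReal_le_ofReal (hb n x))
        (by
          rw [lintegral_const]
          exact ENNReal.mul_ne_top (by simp) (measure_ne_top _ _))
        (Eventually.of_forall fun x => by
          have h1 : Tendsto (fun n => φ n x - f x) atTop (𝓝 0) := by
            simpa using (hlim x).sub_const (f x)
          have h2 := ((ENNReal.continuous_rpow_const (y := 2)).tendsto _).comp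
            (h1.enorm)
          simpa [Function.comp_def] using h2)
      simpa using this
    have h2 := ((ENNReal.continuous_rpow_const (y := 1 / 2)).tendsto _).comp key
    simp only [one_div, inv_pos, Nat.ofNat_pos, ENNReal.zero_rpow_of_pos] at h2
    refine h2.congr fun n => ?_
    rw [eLpNorm_eq_lintegral_rpow_enorm_toReal (by simp) (by simp)]
    simp
  · have hB : ∀ p : ℕ × ℕ, BoundedLip (2 * C * K + 2 * C * K) (fun x => φ p.1 x - φ p.2 x) :=
      fun p => (hmul p.1).sub (hmul p.2)
    have := tendsto_integral_integral_of_dominated (μ := μ) (l := (atTop : Filter (ℕ × ℕ)))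
      (hν.const_mul (2 * (2 * C * K + 2 * C * K) * (2 * C * K + 2 * C * K)))
      (fun p => continuous_increment_mul (hB p).continuous (hB p).continuous)
      (fun p x u => BoundedLip.increment_mul_le (hB p).const_nonneg (hB p).lip (hB p) x u)
      (G := fun _ _ => 0) fun x u => by
        have h : ∀ y, Tendsto (fun p : ℕ × ℕ => φ p.1 y - φ p.2 y) atTop (𝓝 0) := fun y => by
          rw [← prod_atTop_atTop_eq]
          simpa using ((hlim y).comp tendsto_fst).sub ((hlim y).comp tendsto_snd)
        simpa using ((h (x + u)).sub (h x)).mul ((h (x + u)).sub (h x))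
    simpa [nonlocalForm] using this

/-! ### Truncated coordinates -/

lemma abs_coord_le_norm (x : Rd d) (j : Fin d) : |x j| ≤ ‖x‖ := PiLp.norm_apply_le x j

lemma mul_exp_neg_sq_le_one (t : ℝ) : t * Real.exp (-t ^ 2) ≤ 1 := by
  rw [Real.exp_neg, ← div_eq_mul_inv, div_le_one (Real.exp_pos _)]
  nlinarith [Real.add_one_le_exp (t ^ 2), sq_nonneg (t - 1)]

lemma sq_mul_exp_neg_sq_le_one (t : ℝ) : t ^ 2 * Real.exp (-t ^ 2) ≤ 1 := by
  rw [Real.exp_neg, ← div_eq_mul_inv, div_le_one (Real.exp_pos _)]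
  linarith [Real.add_one_le_exp (t ^ 2)]

/-- If `b ≤ 2a`, then `1 - exp(-(b² - a²)) ≤ (b - a)(b + a) ≤ 3a(b - a)` and the remaining `a²
exp(-a²)` is at most one. If `b ≥ 2a`, then already `a ≤ b - a`. -/
lemma mul_exp_neg_sq_sub_le {a b : ℝ} (ha : 0 ≤ a) (hab : a ≤ b) :
    a * (Real.exp (-a ^ 2) - Real.exp (-b ^ 2)) ≤ 3 * (b - a) := by
  have hE : Real.exp (-a ^ 2) ≤ 1 := Real.exp_le_one_iff.2 (by nlinarith)
  rcases le_total b (2 * a) with h | h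
  · have h1 : 1 - (b ^ 2 - a ^ 2) ≤ Real.exp (-(b ^ 2 - a ^ 2)) := by
      linarith [Real.add_one_le_exp (-(b ^ 2 - a ^ 2))]
    have h2 : Real.exp (-b ^ 2) = Real.exp (-a ^ 2) * Real.exp (-(b ^ 2 - a ^ 2)) := by
      rw [← Real.exp_add]
      congr 1
      ring
    have h3 := sq_mul_exp_neg_sq_le_one a
    have hpos := Real.exp_pos (-a ^ 2)
    calc a * (Real.exp (-a ^ 2) - Real.exp (-b ^ 2))
        = a * Real.exp (-a ^ 2) * (1 - Real.exp (-(b ^ 2 - a ^ 2))) := by rw [h2]; ring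
      _ ≤ a * Real.exp (-a ^ 2) * ((b - a) * (3 * a)) := by
          refine mul_le_mul_of_nonneg_left ?_ (by positivity)
          nlinarith
      _ = 3 * (b - a) * (a ^ 2 * Real.exp (-a ^ 2)) := by ring
      _ ≤ 3 * (b - a) := mul_le_of_le_one_right (by linarith) h3
  · have := Real.exp_pos (-b ^ 2)
    nlinarith

lemma norm_smul_sq (c : ℝ) (x : Rd d) : ‖c • x‖ ^ 2 = (|c| * ‖x‖) ^ 2 := by
  rw [norm_smul, Real.norm_eq_abs]

lemma norm_mul_abs_exp_sub_le (c : ℝ) {x y : Rd d} (h : ‖x‖ ≤ ‖y‖) :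
    ‖x‖ * |Real.exp (-‖c • x‖ ^ 2) - Real.exp (-‖c • y‖ ^ 2)| ≤ 3 * ‖x - y‖ := by
  rw [norm_smul_sq, norm_smul_sq]
  rcases eq_or_ne c 0 with rfl | hc
  · simp
  have hc' : 0 < |c| := abs_pos.2 hc
  have hle : |c| * ‖x‖ ≤ |c| * ‖y‖ := mul_le_mul_of_nonneg_left h hc'.le
  have h1 := mul_exp_neg_sq_sub_le (by positivity) hle
  have h2 : Real.exp (-(|c| * ‖y‖) ^ 2) ≤ Real.exp (-(|c| * ‖x‖) ^ 2) :=
    Real.exp_le_exp.2 (neg_le_neg (pow_le_pow_left₀ (by positivity) hle 2))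
  rw [abs_of_nonneg (sub_nonneg.2 h2)]
  have h3 : ‖y‖ - ‖x‖ ≤ ‖x - y‖ := by
    rw [norm_sub_rev]
    exact norm_sub_norm_le y x
  refine le_of_mul_le_mul_left (a := |c|) ?_ hc'
  nlinarith

/-- The constant does not depend on `R`, which is what allows dominated convergence as `R → ∞`. It
is `1` from the increment of the coordinate plus `3` from the increment of the Gaussian factor,
taken at the point of smaller norm. -/
lemma truncCoord_lipschitz (R : ℝ) (j : Fin d) (x y : Rd d) :
    |truncCoord R j x - truncCoord R j y| ≤ 4 * ‖x - y‖ := by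
  wlog h : ‖x‖ ≤ ‖y‖ generalizing x y
  · rw [abs_sub_comm, norm_sub_rev]
    exact this y x (le_of_not_ge h)
  have h1 := norm_mul_abs_exp_sub_le R⁻¹ h
  have h2 : Real.exp (-‖R⁻¹ • y‖ ^ 2) ≤ 1 := Real.exp_le_one_iff.2 (by
    have := sq_nonneg ‖R⁻¹ • y‖
    linarith)
  have h3 : |x j - y j| ≤ ‖x - y‖ := abs_coord_le_norm (x - y) j
  have e : truncCoord R j x - truncCoord R j y = (x j - y j) * Real.exp (-‖R⁻¹ • y‖ ^ 2) +
      x j * (Real.exp (-‖R⁻¹ • x‖ ^ 2) - Real.exp (-‖R⁻¹ • y‖ ^ 2)) := by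
    unfold truncCoord
    ring
  rw [e]
  refine (abs_add_le _ _).trans ?_
  rw [abs_mul, abs_mul, abs_of_pos (Real.exp_pos _)]
  have h4 := mul_le_mul h3 h2 (Real.exp_pos _).le (norm_nonneg _)
  have h5 := mul_le_mul_of_nonneg_right (abs_coord_le_norm x j)
    (abs_nonneg (Real.exp (-‖R⁻¹ • x‖ ^ 2) - Real.exp (-‖R⁻¹ • y‖ ^ 2)))
  linarith

lemma abs_truncCoord_le_norm (R : ℝ) (j : Fin d) (x : Rd d) : |truncCoord R j x| ≤ ‖x‖ := by
  unfold truncCoord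
  rw [abs_mul, abs_of_pos (Real.exp_pos _)]
  refine (mul_le_of_le_one_right (abs_nonneg _) (Real.exp_le_one_iff.2 ?_)).trans
    (abs_coord_le_norm x j)
  have := sq_nonneg ‖R⁻¹ • x‖
  linarith

lemma abs_truncCoord_le {R : ℝ} (hR : 0 < R) (j : Fin d) (x : Rd d) : |truncCoord R j x| ≤ R := by
  unfold truncCoord
  rw [abs_mul, abs_of_pos (Real.exp_pos _)]
  -- With `t = ‖x‖ / R` the quantity is at most `R * (t exp(-t²))`.
  have h := mul_exp_neg_sq_le_one ‖R⁻¹ • x‖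
  have h2 : ‖R⁻¹ • x‖ = R⁻¹ * ‖x‖ := by rw [norm_smul, Real.norm_of_nonneg (inv_nonneg.2 hR.le)]
  refine (mul_le_mul_of_nonneg_right (abs_coord_le_norm x j) (Real.exp_pos _).le).trans ?_
  calc ‖x‖ * Real.exp (-‖R⁻¹ • x‖ ^ 2) = R * (‖R⁻¹ • x‖ * Real.exp (-‖R⁻¹ • x‖ ^ 2)) := by
        nth_rewrite 2 [h2]
        field_simp
    _ ≤ R := mul_le_of_le_one_right hR.le h

lemma contDiff_truncCoord (R : ℝ) (j : Fin d) : ContDiff ℝ ∞ (truncCoord R j) := by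
  have h1 : ContDiff ℝ ∞ fun x : Rd d => ‖R⁻¹ • x‖ ^ 2 := (contDiff_const_smul _).norm_sq ℝ
  have h2 : ContDiff ℝ ∞ fun x : Rd d => x j :=
    (EuclideanSpace.proj j : Rd d →L[ℝ] ℝ).contDiff
  exact h2.mul h1.neg.exp

lemma boundedLip_truncCoord {R : ℝ} (hR : 0 < R) (j : Fin d) :
    BoundedLip (max R 4) (truncCoord (d := d) R j) :=
  ⟨fun x => (abs_truncCoord_le hR j x).trans (le_max_left _ _), fun x y =>
    (truncCoord_lipschitz R j x y).trans
      (mul_le_mul_of_nonneg_right (le_max_right _ _) (norm_nonneg _))⟩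

lemma tendsto_truncCoord (j : Fin d) (x : Rd d) :
    Tendsto (fun R : ℝ => truncCoord R j x) atTop (𝓝 (x j)) := by
  have h : Continuous fun c : ℝ => x j * Real.exp (-‖c • x‖ ^ 2) := by fun_prop
  simpa [truncCoord, Function.comp_def] using (h.tendsto 0).comp tendsto_inv_atTop_zero

/-! ### The variational argument -/

section Variational

variable {ν μ : Measure (Rd d)} [SFinite ν] [IsProbabilityMeasure μ] {U : ℝ}

/-- Subtracting the mean of `f` makes it admissible and leaves the form unchanged, since the form
only sees increments. -/
lemma NonlocalPoincare.variance_le (hU : NonlocalPoincare ν μ U)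
    (hν : Integrable (levyWeight (d := d)) ν) {f : Rd d → ℝ} {C : ℝ} (hf : BoundedLip C f)
    (hf' : ContDiff ℝ ∞ f) :
    ∫ x, f x * f x ∂μ - (∫ x, f x ∂μ) ^ 2 ≤ U * nonlocalForm ν μ f f := by
  set c := ∫ x, f x ∂μ with hc
  have h := hU (fun x => f x - c)
    (inFormDomain_of_contDiff hν (hf.sub (BoundedLip.const c)) (hf'.sub contDiff_const)) (by
      rw [integral_sub hf.integrable (integrable_const c)]
      simp [hc])
  have h1 : ∫ x, |f x - c| ^ 2 ∂μ = ∫ x, f x * f x ∂μ - c ^ 2 := by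
    have e : ∀ x, |f x - c| ^ 2 = f x * f x - (2 * c * f x - c ^ 2) := fun x => by
      rw [sq_abs]
      ring
    have i2 : Integrable (fun x => 2 * c * f x) μ := hf.integrable.const_mul _
    simp only [e]
    have i3 : Integrable (fun x => 2 * c * f x - c ^ 2) μ := i2.sub (integrable_const _)
    rw [integral_sub (hf.mul hf).integrable i3,
      integral_sub i2 (integrable_const _), integral_const_mul, ← hc]
    simp
    ring
  rw [h1] at h
  simpa [nonlocalForm, sq_abs, sq] using h

/-- Cauchy–Schwarz for the nonnegative form `U * nonlocalForm - covariance`. -/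
lemma NonlocalPoincare.cauchy_schwarz (hU : NonlocalPoincare ν μ U)
    (hν : Integrable (levyWeight (d := d)) ν) {f g : Rd d → ℝ} {C D : ℝ} (hf : BoundedLip C f)
    (hf' : ContDiff ℝ ∞ f) (hg : BoundedLip D g) (hg' : ContDiff ℝ ∞ g)
    (hf0 : ∫ x, f x ∂μ = 0) :
    (U * nonlocalForm ν μ f g - ∫ x, f x * g x ∂μ) ^ 2 ≤
      (U * nonlocalForm ν μ f f - ∫ x, f x * f x ∂μ) *
        (U * nonlocalForm ν μ g g - (∫ x, g x * g x ∂μ - (∫ x, g x ∂μ) ^ 2)) := by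
  -- The variance inequality for `s f + g` is a nonnegative quadratic polynomial in `s`; since `f`
  -- is centred, the mean of `s f + g` does not involve `s`. The claim is that its discriminant is
  -- nonpositive.
  have key : ∀ s : ℝ, 0 ≤ (U * nonlocalForm ν μ f f - ∫ x, f x * f x ∂μ) * (s * s) +
      2 * (U * nonlocalForm ν μ f g - ∫ x, f x * g x ∂μ) * s +
      (U * nonlocalForm ν μ g g - (∫ x, g x * g x ∂μ - (∫ x, g x ∂μ) ^ 2)) := by
    intro s
    have h := hU.variance_le hν ((hf.const_mul s).add hg) ((contDiff_const.mul hf').add hg')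
    rw [nonlocalForm_self_mul_add hν hf hg] at h
    have e1 : ∫ x, (s * f x + g x) ∂μ = ∫ x, g x ∂μ := by
      rw [integral_add (hf.integrable.const_mul s) hg.integrable, integral_const_mul, hf0]
      ring
    have e2 : ∫ x, (s * f x + g x) * (s * f x + g x) ∂μ =
        s ^ 2 * ∫ x, f x * f x ∂μ + 2 * s * ∫ x, f x * g x ∂μ + ∫ x, g x * g x ∂μ := by
      have i1 : Integrable (fun x => s ^ 2 * (f x * f x)) μ := (hf.mul hf).integrable.const_mul _
      have i2 : Integrable (fun x => 2 * s * (f x * g x)) μ := (hf.mul hg).integrable.const_mul _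
      have i3 : Integrable (fun x => s ^ 2 * (f x * f x) + 2 * s * (f x * g x)) μ := i1.add i2
      rw [← integral_const_mul, ← integral_const_mul, ← integral_add i1 i2,
        ← integral_add i3 (hg.mul hg).integrable]
      refine integral_congr_ae (Eventually.of_forall fun x => ?_)
      dsimp only
      ring
    rw [e1, e2] at h
    nlinarith
  have := discrim_le_zero key
  rw [discrim] at this
  nlinarith

/-- The Stein identity for the coordinate `x_j`. -/
lemma stein_identity_coord (hU : NonlocalPoincare ν μ U) (hW : WeylCondition ν μ U)
    (hν : Integrable (levyWeight (d := d)) ν) (hμ : Integrable (fun x => ‖x‖) μ)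
    (hμ0 : ∀ j : Fin d, ∫ x, x j ∂μ = 0) {f : Rd d → ℝ} {C : ℝ} (hf : BoundedLip C f)
    (hf' : ContDiff ℝ ∞ f) (j : Fin d) :
    U * ∫ x, ∫ u, u j * (f (x + u) - f x) ∂ν ∂μ = ∫ x, x j * f x ∂μ := by
  have hmean : Tendsto (fun R : ℝ => ∫ y, truncCoord R j y ∂μ) atTop (𝓝 0) := by
    rw [← hμ0 j]
    exact tendsto_integral_filter_of_dominated_convergence (fun x => ‖x‖)
      (Eventually.of_forall fun R => (contDiff_truncCoord R j).continuous.aestronglyMeasurable)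
      (Eventually.of_forall fun R => Eventually.of_forall fun x => abs_truncCoord_le_norm R j x)
      hμ (Eventually.of_forall fun x => tendsto_truncCoord j x)
  have hprod : Tendsto (fun R : ℝ => ∫ y, truncCoord R j y * f y ∂μ) atTop
      (𝓝 (∫ x, x j * f x ∂μ)) := by
    refine tendsto_integral_filter_of_dominated_convergence (fun x => ‖x‖ * C)
      (Eventually.of_forall fun R =>
        ((contDiff_truncCoord R j).continuous.mul hf.continuous).aestronglyMeasurable)
      (Eventually.of_forall fun R => Eventually.of_forall fun x => ?_)
      (hμ.mul_const C) (Eventually.of_forall fun x => (tendsto_truncCoord j x).mul_const (f x))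
    rw [Real.norm_eq_abs, abs_mul]
    exact mul_le_mul (abs_truncCoord_le_norm R j x) (hf.bound x) (abs_nonneg _) (norm_nonneg _)
  have hform : Tendsto (fun R : ℝ => nonlocalForm ν μ (truncCoord R j) f) atTop
      (𝓝 (∫ x, ∫ u, u j * (f (x + u) - f x) ∂ν ∂μ)) := by
    refine tendsto_integral_integral_of_dominated (hν.const_mul (2 * 4 * C))
      (fun R => continuous_increment_mul (contDiff_truncCoord R j).continuous hf.continuous)
      (fun R x u => BoundedLip.increment_mul_le (by norm_num) (truncCoord_lipschitz R j) hf x u)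
      fun x u => ?_
    have := (tendsto_truncCoord j (x + u)).sub (tendsto_truncCoord j x)
    simp only [PiLp.add_apply, add_sub_cancel_left] at this
    exact this.mul_const _
  -- The Cauchy–Schwarz factor belonging to `f`; it is independent of `R`, so the other factor,
  -- which vanishes by the Weyl condition, decides the limit.
  set V := U * nonlocalForm ν μ f f - (∫ x, f x * f x ∂μ - (∫ x, f x ∂μ) ^ 2)
  have hcov : Tendsto (fun R : ℝ => U * nonlocalForm ν μ (truncCoord R j) f -
      (∫ y, truncCoord R j y * f y ∂μ - (∫ y, truncCoord R j y ∂μ) * ∫ y, f y ∂μ)) atTop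
      (𝓝 (U * (∫ x, ∫ u, u j * (f (x + u) - f x) ∂ν ∂μ) - (∫ x, x j * f x ∂μ -
        0 * ∫ y, f y ∂μ))) :=
    (hform.const_mul U).sub (hprod.sub (hmean.mul_const _))
  have hzero : Tendsto (fun R : ℝ => (U * nonlocalForm ν μ (truncCoord R j) f -
      (∫ y, truncCoord R j y * f y ∂μ - (∫ y, truncCoord R j y ∂μ) * ∫ y, f y ∂μ)) ^ 2) atTop
      (𝓝 0) := by
    have hWj := (hW j).mul_const V
    rw [zero_mul] at hWj
    refine tendsto_of_tendsto_of_tendsto_of_le_of_le' tendsto_const_nhds hWj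
      (Eventually.of_forall fun R => sq_nonneg _) ?_
    filter_upwards [eventually_gt_atTop 0] with R hR
    have hT := boundedLip_truncCoord hR j
    have hg : BoundedLip _ (centeredTruncCoord μ R j) := hT.sub (BoundedLip.const _)
    have hg' : ContDiff ℝ ∞ (centeredTruncCoord μ R j) :=
      (contDiff_truncCoord R j).sub contDiff_const
    have hg0 : ∫ x, centeredTruncCoord μ R j x ∂μ = 0 := by
      unfold centeredTruncCoord
      rw [integral_sub hT.integrable (integrable_const _)]
      simp
    have h := hU.cauchy_schwarz hν hg hg' hf hf' hg0
    have e1 : nonlocalForm ν μ (centeredTruncCoord μ R j) f =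
        nonlocalForm ν μ (truncCoord R j) f :=
      nonlocalForm_sub_const _ (truncCoord R j) f
    have e2 : ∫ x, centeredTruncCoord μ R j x * f x ∂μ =
        ∫ y, truncCoord R j y * f y ∂μ - (∫ y, truncCoord R j y ∂μ) * ∫ y, f y ∂μ := by
      simp only [centeredTruncCoord, sub_mul]
      rw [integral_sub (hT.mul hf).integrable (hf.integrable.const_mul _), integral_const_mul]
    rw [e1, e2] at h
    rwa [nonlocalForm_const_mul_left]
  -- The squared pairing tends both to the square of the defect in the Stein identity and to zero.
  have := tendsto_nhds_unique (hcov.pow 2) hzero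
  rw [sq_eq_zero_iff, zero_mul, sub_zero, sub_eq_zero] at this
  exact this

end Variational

/-! ### Bounds on complex exponentials -/

lemma norm_cexp_sub_one_le (a : ℝ) : ‖Complex.exp (a * Complex.I) - 1‖ ≤ 2 * min 1 |a| := by
  rw [mul_min_of_nonneg _ _ zero_le_two]
  refine le_min ?_ ?_
  · refine (norm_sub_le _ _).trans ?_
    rw [Complex.norm_exp_ofReal_mul_I, norm_one]
    norm_num
  · have := Real.norm_exp_I_mul_ofReal_sub_one_le (x := a)
    rw [mul_comm] at this
    exact this.trans (by rw [Real.norm_eq_abs]; linarith [abs_nonneg a])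

lemma norm_cexp_sub_one_sub_le (a : ℝ) :
    ‖Complex.exp (a * Complex.I) - 1 - a * Complex.I‖ ≤ |a| * (2 * min 1 |a|) := by
  have hn : ‖(a : ℂ) * Complex.I‖ = |a| := by simp
  rcases le_total |a| 1 with h | h
  · have := Complex.norm_exp_sub_one_sub_id_le (hn.trans_le h)
    rw [hn] at this
    rw [min_eq_right h]
    nlinarith [sq_nonneg |a|]
  · have h1 := Real.norm_exp_I_mul_ofReal_sub_one_le (x := a)
    rw [mul_comm, Real.norm_eq_abs] at h1
    rw [min_eq_left h]
    refine (norm_sub_le _ _).trans ?_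
    rw [hn]
    linarith

/-- Keeping `t` explicit makes the resulting bounds locally uniform in `t`, as differentiation under
the integral requires. -/
lemma min_one_abs_mul_inner_le (ξ u : Rd d) (t : ℝ) :
    min 1 |t * inner ℝ u ξ| ≤ (1 + |t| * ‖ξ‖) * min 1 ‖u‖ := by
  have h0 : |t * inner ℝ u ξ| ≤ |t| * ‖ξ‖ * ‖u‖ := by
    rw [abs_mul, mul_assoc, mul_comm ‖ξ‖]
    exact mul_le_mul_of_nonneg_left (abs_real_inner_le_norm u ξ) (abs_nonneg t)
  have h1 : 0 ≤ |t| * ‖ξ‖ := by positivity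
  rcases le_total ‖u‖ 1 with h | h
  · rw [min_eq_right h]
    exact (min_le_right _ _).trans (h0.trans (by nlinarith [norm_nonneg u]))
  · rw [min_eq_left h]
    exact (min_le_left _ _).trans (by linarith)

lemma norm_inner_mul_cexp_sub_one_le (v ξ u : Rd d) (t : ℝ) :
    ‖((inner ℝ u v : ℝ) : ℂ) * (Complex.exp ((t * inner ℝ u ξ : ℝ) * Complex.I) - 1)‖ ≤
      ‖v‖ * (2 * (1 + |t| * ‖ξ‖)) * levyWeight u := by
  rw [norm_mul, Complex.norm_real, Real.norm_eq_abs]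
  refine (mul_le_mul (abs_real_inner_le_norm u v) ((norm_cexp_sub_one_le _).trans
    (mul_le_mul_of_nonneg_left (min_one_abs_mul_inner_le ξ u t) zero_le_two))
    (norm_nonneg _) (by positivity)).trans (le_of_eq ?_)
  unfold levyWeight
  ring

/-- The integrand of the fully compensated Lévy–Khintchine exponent. -/
noncomputable def compExp (ξ u : Rd d) : ℂ :=
  Complex.exp ((inner ℝ u ξ : ℝ) * Complex.I) - 1 - (inner ℝ u ξ : ℝ) * Complex.I

/-- The fully compensated Lévy–Khintchine exponent. -/
noncomputable def levyExponent (ν : Measure (Rd d)) (ξ : Rd d) : ℂ := ∫ u, compExp ξ u ∂ν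

lemma norm_compExp_le (ξ u : Rd d) :
    ‖compExp ξ u‖ ≤ ‖ξ‖ * (2 * (1 + ‖ξ‖)) * levyWeight u := by
  have h := min_one_abs_mul_inner_le ξ u 1
  rw [one_mul, abs_one, one_mul] at h
  refine (norm_cexp_sub_one_sub_le _).trans ((mul_le_mul (abs_real_inner_le_norm u ξ)
    (mul_le_mul_of_nonneg_left h zero_le_two) (by positivity) (by positivity)).trans
    (le_of_eq ?_))
  unfold levyWeight
  ring

lemma continuous_compExp (ξ : Rd d) : Continuous (compExp ξ) := by
  unfold compExp
  fun_prop

lemma integrable_compExp {ν : Measure (Rd d)} (hν : Integrable (levyWeight (d := d)) ν)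
    (ξ : Rd d) : Integrable (compExp ξ) ν :=
  (hν.const_mul _).mono' (continuous_compExp ξ).aestronglyMeasurable
    (Eventually.of_forall (norm_compExp_le ξ))

/-! ### The Stein identity for characters -/

section Characters

variable {ν μ : Measure (Rd d)} {U : ℝ}

lemma inner_eq_sum_mul (u v : Rd d) : inner ℝ u v = ∑ j, v j * u j := by
  simp [PiLp.inner_apply]

lemma integrable_coord_mul_increment (hν : Integrable (levyWeight (d := d)) ν) {f : Rd d → ℝ}
    {C : ℝ} (hf : BoundedLip C f) (v x : Rd d) :
    Integrable (fun u => inner ℝ u v * (f (x + u) - f x)) ν := by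
  have hc := hf.continuous
  refine (hν.const_mul (2 * ‖v‖ * C)).mono' (Continuous.aestronglyMeasurable (by fun_prop))
    (Eventually.of_forall fun u => ?_)
  have := BoundedLip.increment_mul_le (g := fun y => inner ℝ y v) (norm_nonneg v)
    (fun y z => by
      rw [← inner_sub_left, mul_comm]
      exact abs_real_inner_le_norm _ _) hf x u
  simpa [inner_add_left] using this

lemma integrable_integral_coord_mul_increment [SFinite ν] [IsProbabilityMeasure μ]
    (hν : Integrable (levyWeight (d := d)) ν)
    {f : Rd d → ℝ} {C : ℝ} (hf : BoundedLip C f) (v : Rd d) :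
    Integrable (fun x => ∫ u, inner ℝ u v * (f (x + u) - f x) ∂ν) μ := by
  have hc := hf.continuous
  have hj : Continuous fun p : Rd d × Rd d => inner ℝ p.2 v * (f (p.1 + p.2) - f p.1) := by
    fun_prop
  refine Integrable.of_bound (C := ∫ u, 2 * ‖v‖ * C * levyWeight u ∂ν)
    hj.stronglyMeasurable.integral_prod_right'.aestronglyMeasurable
    (Eventually.of_forall fun x => norm_integral_le_of_norm_le (hν.const_mul _)
      (Eventually.of_forall fun u => ?_))
  have := BoundedLip.increment_mul_le (g := fun y => inner ℝ y v) (norm_nonneg v)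
    (fun y z => by
      rw [← inner_sub_left, mul_comm]
      exact abs_real_inner_le_norm _ _) hf x u
  simpa [inner_add_left] using this

lemma integrable_inner_mul_of_boundedLip (hμ : Integrable (fun x => ‖x‖) μ) {f : Rd d → ℝ} {C : ℝ}
    (hf : BoundedLip C f) (v : Rd d) : Integrable (fun x => inner ℝ x v * f x) μ := by
  have hc := hf.continuous
  refine (hμ.mul_const (‖v‖ * C)).mono' (Continuous.aestronglyMeasurable (by fun_prop))
    (Eventually.of_forall fun x => ?_)
  rw [Real.norm_eq_abs, abs_mul, ← mul_assoc]
  exact mul_le_mul (abs_real_inner_le_norm x v) (hf.bound x) (abs_nonneg _) (by positivity)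

/-- The Stein identity in an arbitrary direction. -/
lemma stein_identity [SFinite ν] [IsProbabilityMeasure μ]
    (hU : NonlocalPoincare ν μ U) (hW : WeylCondition ν μ U)
    (hν : Integrable (levyWeight (d := d)) ν) (hμ : Integrable (fun x => ‖x‖) μ)
    (hμ0 : ∀ j : Fin d, ∫ x, x j ∂μ = 0) {f : Rd d → ℝ} {C : ℝ} (hf : BoundedLip C f)
    (hf' : ContDiff ℝ ∞ f) (v : Rd d) :
    U * ∫ x, ∫ u, inner ℝ u v * (f (x + u) - f x) ∂ν ∂μ = ∫ x, inner ℝ x v * f x ∂μ := by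
  -- Coordinates are inner products with basis vectors, so the integrability lemmas for a general
  -- direction cover each summand.
  have hs : ∀ (j : Fin d) (u : Rd d), inner ℝ u (EuclideanSpace.single j (1 : ℝ)) = u j :=
    fun j u => by simp [EuclideanSpace.inner_single_right]
  have i1 : ∀ (j : Fin d) x, Integrable (fun u => v j * (u j * (f (x + u) - f x))) ν :=
    fun j x => by
      simpa only [hs] using
        (integrable_coord_mul_increment hν hf (EuclideanSpace.single j 1) x).const_mul (v j)
  have i2 : ∀ j : Fin d, Integrable (fun x => v j * ∫ u, u j * (f (x + u) - f x) ∂ν) μ :=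
    fun j => by
      simpa only [hs] using (integrable_integral_coord_mul_increment hν hf
        (EuclideanSpace.single j 1)).const_mul (v j)
  have i3 : ∀ j : Fin d, Integrable (fun x => v j * (x j * f x)) μ := fun j => by
    simpa only [hs] using
      (integrable_inner_mul_of_boundedLip hμ hf (EuclideanSpace.single j 1)).const_mul (v j)
  simp only [inner_eq_sum_mul, Finset.sum_mul, mul_assoc]
  rw [integral_finsetSum _ fun j _ => i3 j]
  have e : ∀ x, ∫ u, ∑ j, v j * (u j * (f (x + u) - f x)) ∂ν =
      ∑ j, v j * ∫ u, u j * (f (x + u) - f x) ∂ν := fun x => by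
    rw [integral_finsetSum _ fun j _ => i1 j x]
    simp only [integral_const_mul]
  simp only [e]
  rw [integral_finsetSum _ fun j _ => i2 j, Finset.mul_sum]
  refine Finset.sum_congr rfl fun j _ => ?_
  rw [integral_const_mul, integral_const_mul, ← stein_identity_coord hU hW hν hμ hμ0 hf hf' j]
  ring

lemma boundedLip_cos_inner (ξ : Rd d) :
    BoundedLip (max 1 ‖ξ‖) (fun x : Rd d => Real.cos (inner ℝ x ξ)) := by
  refine ⟨fun x => (Real.abs_cos_le_one _).trans (le_max_left _ _), fun x y => ?_⟩
  refine (Real.abs_cos_sub_cos_le _ _).trans ?_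
  rw [← inner_sub_left, mul_comm]
  exact (abs_real_inner_le_norm _ _).trans
    (mul_le_mul_of_nonneg_left (le_max_right _ _) (norm_nonneg _))

lemma boundedLip_sin_inner (ξ : Rd d) :
    BoundedLip (max 1 ‖ξ‖) (fun x : Rd d => Real.sin (inner ℝ x ξ)) := by
  refine ⟨fun x => (Real.abs_sin_le_one _).trans (le_max_left _ _), fun x y => ?_⟩
  refine (Real.abs_sin_sub_sin_le _ _).trans ?_
  rw [← inner_sub_left, mul_comm]
  exact (abs_real_inner_le_norm _ _).trans
    (mul_le_mul_of_nonneg_left (le_max_right _ _) (norm_nonneg _))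

/-- The Stein identity for the character `x ↦ exp (i ⟪x, ξ⟫)`. -/
lemma stein_identity_character [SFinite ν] [IsProbabilityMeasure μ]
    (hU : NonlocalPoincare ν μ U) (hW : WeylCondition ν μ U)
    (hν : Integrable (levyWeight (d := d)) ν) (hμ : Integrable (fun x => ‖x‖) μ)
    (hμ0 : ∀ j : Fin d, ∫ x, x j ∂μ = 0) (v ξ : Rd d) :
    (U : ℂ) * (charFun μ ξ * ∫ u, ((inner ℝ u v : ℝ) : ℂ) *
      (Complex.exp ((inner ℝ u ξ : ℝ) * Complex.I) - 1) ∂ν) =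
      ∫ x, ((inner ℝ x v : ℝ) : ℂ) * Complex.exp ((inner ℝ x ξ : ℝ) * Complex.I) ∂μ := by
  have hc := boundedLip_cos_inner ξ
  have hs := boundedLip_sin_inner ξ
  have hc' : ContDiff ℝ ∞ fun x : Rd d => Real.cos (inner ℝ x ξ) :=
    (contDiff_id.inner ℝ contDiff_const).cos
  have hs' : ContDiff ℝ ∞ fun x : Rd d => Real.sin (inner ℝ x ξ) :=
    (contDiff_id.inner ℝ contDiff_const).sin
  have sc := stein_identity hU hW hν hμ hμ0 hc hc' v
  have ss := stein_identity hU hW hν hμ hμ0 hs hs' v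
  have he : ∀ x : Rd d, Complex.exp ((inner ℝ x ξ : ℝ) * Complex.I) =
      (Real.cos (inner ℝ x ξ) : ℂ) + (Real.sin (inner ℝ x ξ) : ℂ) * Complex.I := fun x => by
    rw [Complex.exp_mul_I, Complex.ofReal_cos, Complex.ofReal_sin]
  have combine : ∀ (κ : Measure (Rd d)) {p q : Rd d → ℝ}, Integrable p κ → Integrable q κ →
      ∫ x, ((p x : ℂ) + (q x : ℂ) * Complex.I) ∂κ =
        ((∫ x, p x ∂κ : ℝ) : ℂ) + ((∫ x, q x ∂κ : ℝ) : ℂ) * Complex.I := by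
    intro κ p q hp hq
    rw [integral_add hp.ofReal (hq.ofReal.mul_const _), integral_mul_const]
    simp only [integral_complex_ofReal]
  -- The increment of a character factors as `exp(i⟪x, ξ⟫) (exp(i⟪u, ξ⟫) - 1)`, which separates the
  -- two integrals.
  have hleft : charFun μ ξ * ∫ u, ((inner ℝ u v : ℝ) : ℂ) *
      (Complex.exp ((inner ℝ u ξ : ℝ) * Complex.I) - 1) ∂ν =
      ∫ x, (((∫ u, inner ℝ u v * (Real.cos (inner ℝ (x + u) ξ) - Real.cos (inner ℝ x ξ)) ∂ν : ℝ) : ℂ)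
        + ((∫ u, inner ℝ u v * (Real.sin (inner ℝ (x + u) ξ) - Real.sin (inner ℝ x ξ)) ∂ν : ℝ) : ℂ)
          * Complex.I) ∂μ := by
    rw [charFun_apply, ← integral_mul_const]
    refine integral_congr_ae (Eventually.of_forall fun x => ?_)
    dsimp only
    rw [← combine ν (integrable_coord_mul_increment hν hc v x)
      (integrable_coord_mul_increment hν hs v x), ← integral_const_mul]
    refine integral_congr_ae (Eventually.of_forall fun u => ?_)
    have h1 := he (x + u)
    rw [inner_add_left, Complex.ofReal_add, add_mul, Complex.exp_add] at h1
    have h2 := he x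
    simp only [inner_add_left, Complex.ofReal_mul, Complex.ofReal_sub] at h1 ⊢
    linear_combination ((inner ℝ u v : ℝ) : ℂ) * h1 - ((inner ℝ u v : ℝ) : ℂ) * h2
  have hright : ∫ x, ((inner ℝ x v : ℝ) : ℂ) * Complex.exp ((inner ℝ x ξ : ℝ) * Complex.I) ∂μ =
      ∫ x, (((inner ℝ x v * Real.cos (inner ℝ x ξ) : ℝ) : ℂ) +
        ((inner ℝ x v * Real.sin (inner ℝ x ξ) : ℝ) : ℂ) * Complex.I) ∂μ := by
    refine integral_congr_ae (Eventually.of_forall fun x => ?_)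
    dsimp only
    rw [he x, Complex.ofReal_mul, Complex.ofReal_mul]
    ring
  rw [hleft, hright, combine μ (integrable_integral_coord_mul_increment hν hc v)
      (integrable_integral_coord_mul_increment hν hs v),
    combine μ (integrable_inner_mul_of_boundedLip hμ hc v)
      (integrable_inner_mul_of_boundedLip hμ hs v), ← sc, ← ss]
  push_cast
  ring

end Characters

/-! ### Identification of the characteristic function -/

lemma hasDerivAt_cexp_mul_inner (a t : ℝ) :
    HasDerivAt (fun t : ℝ => Complex.exp ((t * a : ℝ) * Complex.I))
      ((a : ℂ) * Complex.I * Complex.exp ((t * a : ℝ) * Complex.I)) t := by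
  have h1 : HasDerivAt (fun t : ℝ => ((t * a : ℝ) : ℂ) * Complex.I) ((a : ℂ) * Complex.I) t := by
    simpa using ((hasDerivAt_mul_const a).ofReal_comp (z := t)).mul_const Complex.I
  simpa [mul_comm] using h1.cexp

lemma hasDerivAt_charFun_smul {μ : Measure (Rd d)} [IsProbabilityMeasure μ]
    (hμ : Integrable (fun x => ‖x‖) μ) (ξ : Rd d) (t : ℝ) :
    HasDerivAt (fun t : ℝ => charFun μ (t • ξ)) (Complex.I * ∫ x, ((inner ℝ x ξ : ℝ) : ℂ) *
      Complex.exp ((inner ℝ x (t • ξ) : ℝ) * Complex.I) ∂μ) t := by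
  simp only [charFun_apply, inner_smul_right]
  rw [← integral_const_mul]
  have h := (hasDerivAt_integral_of_dominated_loc_of_deriv_le (μ := μ) (x₀ := t)
    (s := Set.univ) (bound := fun x => ‖x‖ * ‖ξ‖)
    (F := fun t x => Complex.exp ((t * inner ℝ x ξ : ℝ) * Complex.I))
    (F' := fun t x => (inner ℝ x ξ : ℂ) * Complex.I *
      Complex.exp ((t * inner ℝ x ξ : ℝ) * Complex.I)) univ_mem
    (Eventually.of_forall fun t => Continuous.aestronglyMeasurable (by fun_prop))
    (Integrable.of_bound (C := 1) (Continuous.aestronglyMeasurable (by fun_prop))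
      (Eventually.of_forall fun x => (Complex.norm_exp_ofReal_mul_I _).le))
    (Continuous.aestronglyMeasurable (by fun_prop))
    (Eventually.of_forall fun x t _ => by
      rw [norm_mul, Complex.norm_exp_ofReal_mul_I, norm_mul, Complex.norm_I, Complex.norm_real,
        mul_one, mul_one]
      exact abs_real_inner_le_norm x ξ)
    (hμ.mul_const _)
    (Eventually.of_forall fun x t _ => hasDerivAt_cexp_mul_inner _ t)).2
  refine h.congr_deriv (integral_congr_ae (Eventually.of_forall fun x => ?_))
  dsimp only
  ring

lemma hasDerivAt_levyExponent_smul {ν : Measure (Rd d)}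
    (hν : Integrable (levyWeight (d := d)) ν) (ξ : Rd d) (t : ℝ) :
    HasDerivAt (fun t : ℝ => levyExponent ν (t • ξ)) (Complex.I * ∫ u, ((inner ℝ u ξ : ℝ) : ℂ) *
      (Complex.exp ((inner ℝ u (t • ξ) : ℝ) * Complex.I) - 1) ∂ν) t := by
  simp only [levyExponent, compExp, inner_smul_right]
  rw [← integral_const_mul]
  have h := (hasDerivAt_integral_of_dominated_loc_of_deriv_le (μ := ν) (x₀ := t)
    -- The derivative of the integrand is dominated only locally in `t`: on this ball the parameter
    -- is at most `|t| + 1` in absolute value.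
    (s := Metric.ball t 1)
    (bound := fun u => ‖ξ‖ * (2 * (1 + (|t| + 1) * ‖ξ‖)) * levyWeight u)
    (F := fun t u => Complex.exp ((t * inner ℝ u ξ : ℝ) * Complex.I) - 1 -
      (t * inner ℝ u ξ : ℝ) * Complex.I)
    (F' := fun t u => Complex.I * ((inner ℝ u ξ : ℂ) *
      (Complex.exp ((t * inner ℝ u ξ : ℝ) * Complex.I) - 1))) (Metric.ball_mem_nhds t one_pos)
    (Eventually.of_forall fun t => Continuous.aestronglyMeasurable (by fun_prop))
    ((integrable_compExp hν (t • ξ)).congr (Eventually.of_forall fun u => by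
      simp only [compExp, inner_smul_right]))
    (Continuous.aestronglyMeasurable (by fun_prop))
    (Eventually.of_forall fun u s hs => by
      rw [norm_mul, Complex.norm_I, one_mul]
      refine (norm_inner_mul_cexp_sub_one_le ξ ξ u s).trans ?_
      have h1 : |s| ≤ |t| + 1 := by
        rw [Metric.mem_ball, Real.dist_eq] at hs
        linarith [abs_sub_abs_le_abs_sub s t]
      have h2 := levyWeight_nonneg u
      gcongr)
    (hν.const_mul _)
    (Eventually.of_forall fun u s _ => by
      have h1 : HasDerivAt (fun t : ℝ => ((t * inner ℝ u ξ : ℝ) : ℂ) * Complex.I)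
          ((inner ℝ u ξ : ℂ) * Complex.I) s := by
        simpa using ((hasDerivAt_mul_const (inner ℝ u ξ : ℝ)).ofReal_comp (z := s)).mul_const
          Complex.I
      refine (((hasDerivAt_cexp_mul_inner (inner ℝ u ξ) s).sub_const 1).sub h1).congr_deriv ?_
      ring)).2
  exact h

/-- The Poincaré inequality together with the Weyl condition determine the characteristic
function. -/
lemma charFun_eq_exp_levyExponent {ν μ : Measure (Rd d)} [SFinite ν] [IsProbabilityMeasure μ]
    {U : ℝ} (hU : NonlocalPoincare ν μ U) (hW : WeylCondition ν μ U)
    (hν : Integrable (levyWeight (d := d)) ν) (hμ : Integrable (fun x => ‖x‖) μ)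
    (hμ0 : ∀ j : Fin d, ∫ x, x j ∂μ = 0) (ξ : Rd d) :
    charFun μ ξ = Complex.exp (U * levyExponent ν ξ) := by
  -- Integrating factor: the derivative vanishes by the Stein identity for the character at `t • ξ`
  -- in the direction `ξ`.
  have hderiv : ∀ t : ℝ, HasDerivAt
      (fun t : ℝ => charFun μ (t • ξ) * Complex.exp (-(U * levyExponent ν (t • ξ)))) 0 t := by
    intro t
    have h := (hasDerivAt_charFun_smul hμ ξ t).mul
      ((hasDerivAt_levyExponent_smul hν ξ t).const_mul (U : ℂ)).neg.cexp
    refine h.congr_deriv ?_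
    rw [← stein_identity_character hU hW hν hμ hμ0 ξ (t • ξ)]
    ring
  have hconst := is_const_of_deriv_eq_zero (fun t => (hderiv t).differentiableAt)
    (fun t => (hderiv t).deriv) 1 0
  have h0 : levyExponent ν (0 : Rd d) = 0 := by simp [levyExponent, compExp]
  simp only [one_smul, zero_smul, h0, charFun_zero, mul_zero, neg_zero, Complex.exp_zero,
    probReal_univ, Complex.ofReal_one, mul_one] at hconst
  rw [Complex.exp_neg, mul_inv_eq_one₀ (Complex.exp_ne_zero _)] at hconst
  exact hconst

variable {α : ℝ}

/-! ### The stable Lévy measure -/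

/-- The density of the stable Lévy measure. -/
noncomputable def stableDensity (α : ℝ) (d : ℕ) (u : Rd d) : ℝ :=
  stableConst α d / ‖u‖ ^ ((d : ℝ) + α)

lemma stableLevyMeasure_eq (α : ℝ) (d : ℕ) : stableLevyMeasure α d =
    volume.withDensity fun u => ENNReal.ofReal (stableDensity α d u) := rfl

lemma measurable_stableDensity (α : ℝ) (d : ℕ) : Measurable (stableDensity α d) := by
  unfold stableDensity
  fun_prop

lemma stableConst_pos (hα₁ : 1 < α) (hα₂ : α < 2) (d : ℕ) : 0 < stableConst α d := by
  have hcos : Real.cos (α * Real.pi / 2) < 0 :=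
    Real.cos_neg_of_pi_div_two_lt_of_lt (by nlinarith [Real.pi_pos]) (by nlinarith [Real.pi_pos])
  have h1 : 0 < Real.Gamma ((α + d) / 2) := Real.Gamma_pos_of_pos (by positivity)
  have h2 : 0 < Real.Gamma ((α + 1) / 2) := Real.Gamma_pos_of_pos (by positivity)
  have h3 : 0 < Real.Gamma (2 - α) := Real.Gamma_pos_of_pos (by linarith)
  have h4 : 0 < Real.pi ^ (((d : ℝ) - 1) / 2) := Real.rpow_pos_of_pos Real.pi_pos _
  unfold stableConst
  refine div_pos_of_neg_of_neg ?_ ?_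
  · have : 0 < α * (α - 1) * Real.Gamma ((α + d) / 2) :=
      mul_pos (mul_pos (by linarith) (by linarith)) h1
    linarith
  · have : 0 < -Real.cos (α * Real.pi / 2) * (4 * Real.Gamma ((α + 1) / 2) *
      Real.pi ^ (((d : ℝ) - 1) / 2) * Real.Gamma (2 - α)) :=
      mul_pos (by linarith) (by positivity)
    nlinarith

lemma stableDensity_nonneg (hα₁ : 1 < α) (hα₂ : α < 2) (u : Rd d) : 0 ≤ stableDensity α d u :=
  div_nonneg (stableConst_pos hα₁ hα₂ d).le (by positivity)

lemma stableDensity_pos (hα₁ : 1 < α) (hα₂ : α < 2) {u : Rd d} (hu : u ≠ 0) :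
    0 < stableDensity α d u :=
  div_pos (stableConst_pos hα₁ hα₂ d) (Real.rpow_pos_of_pos (norm_pos_iff.2 hu) _)

instance (α : ℝ) (d : ℕ) : SFinite (stableLevyMeasure α d) := by
  unfold stableLevyMeasure
  infer_instance

lemma integrable_stableLevyMeasure_iff (hα₁ : 1 < α) (hα₂ : α < 2) {g : Rd d → ℝ} :
    Integrable g (stableLevyMeasure α d) ↔ Integrable fun u => g u * stableDensity α d u := by
  rw [stableLevyMeasure_eq, integrable_withDensity_iff (measurable_stableDensity α d).ennreal_ofReal
    (Eventually.of_forall fun _ => ENNReal.ofReal_lt_top)]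
  refine integrable_congr (Eventually.of_forall fun u => ?_)
  dsimp only
  rw [ENNReal.toReal_ofReal (stableDensity_nonneg hα₁ hα₂ u)]

lemma integral_stableLevyMeasure (hα₁ : 1 < α) (hα₂ : α < 2) (g : Rd d → ℂ) :
    ∫ u, g u ∂(stableLevyMeasure α d) = ∫ u, stableDensity α d u • g u := by
  rw [stableLevyMeasure_eq, integral_withDensity_eq_integral_toReal_smul
    (measurable_stableDensity α d).ennreal_ofReal
    (Eventually.of_forall fun _ => ENNReal.ofReal_lt_top)]
  refine integral_congr_ae (Eventually.of_forall fun u => ?_)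
  dsimp only
  rw [ENNReal.toReal_ofReal (stableDensity_nonneg hα₁ hα₂ u)]

lemma integrable_indicator_norm_stableLevyMeasure (hα₁ : 1 < α) (hα₂ : α < 2) :
    Integrable ({u : Rd d | 1 < ‖u‖}.indicator fun u => ‖u‖) (stableLevyMeasure α d) := by
  have hS : MeasurableSet {u : Rd d | 1 < ‖u‖} := measurableSet_lt measurable_const measurable_norm
  rw [integrable_stableLevyMeasure_iff hα₁ hα₂]
  -- For large `u`, `‖u‖` times the density is a multiple of `‖u‖ ^ (-r)`, integrable because `r >
  -- d`, that is, `α > 1`.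
  set r : ℝ := d + α - 1 with hr
  have hr0 : 0 < r := by
    have : (0 : ℝ) ≤ d := Nat.cast_nonneg d
    linarith
  have hint : Integrable (fun u : Rd d => (1 + ‖u‖) ^ (-r)) :=
    integrable_one_add_norm (by rw [finrank_euclideanSpace_fin]; linarith)
  refine (hint.const_mul (stableConst α d * 2 ^ r)).mono'
    ((measurable_norm.indicator hS).mul (measurable_stableDensity α d)).aestronglyMeasurable
    (Eventually.of_forall fun u => ?_)
  have hc := stableConst_pos hα₁ hα₂ d
  by_cases hu : u ∈ {u : Rd d | 1 < ‖u‖}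
  · rw [Set.indicator_of_mem hu]
    have hu1 : 1 < ‖u‖ := hu
    have hu0 : 0 < ‖u‖ := by linarith
    have e : ‖u‖ * stableDensity α d u = stableConst α d * ‖u‖ ^ (-r) := by
      have h1 : (d : ℝ) + α = r + 1 := by rw [hr]; ring
      rw [stableDensity, h1, Real.rpow_add_one hu0.ne', Real.rpow_neg hu0.le]
      field_simp
    rw [e, Real.norm_of_nonneg (by positivity), mul_assoc]
    refine mul_le_mul_of_nonneg_left ?_ hc.le
    have h2 : (2 * ‖u‖) ^ (-r) ≤ (1 + ‖u‖) ^ (-r) :=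
      Real.rpow_le_rpow_of_nonpos (by linarith) (by linarith) (by linarith)
    calc ‖u‖ ^ (-r) = 2 ^ r * (2 * ‖u‖) ^ (-r) := by
          rw [Real.mul_rpow zero_le_two hu0.le, ← mul_assoc, ← Real.rpow_add two_pos,
            add_neg_cancel, Real.rpow_zero, one_mul]
      _ ≤ 2 ^ r * (1 + ‖u‖) ^ (-r) := by gcongr
  · rw [Set.indicator_of_notMem hu, zero_mul, norm_zero]
    positivity

lemma measurable_levyWeight : Measurable (levyWeight (d := d)) := by
  unfold levyWeight
  fun_prop

lemma integrable_min_one_norm_sq {ν : Measure (Rd d)} (h : IsLevyMeasure ν) :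
    Integrable (fun u => min 1 (‖u‖ ^ 2)) ν := by
  refine ⟨Measurable.aestronglyMeasurable (by fun_prop), ?_⟩
  rw [hasFiniteIntegral_iff_ofReal (Eventually.of_forall fun u => le_min zero_le_one (sq_nonneg _))]
  exact h.2

/-- The weight is `‖u‖²` in the unit ball, where the Lévy condition applies, and `‖u‖` outside,
where `α > 1` is used. -/
lemma integrable_levyWeight (hα₁ : 1 < α) (hα₂ : α < 2)
    (h : IsLevyMeasure (stableLevyMeasure α d)) :
    Integrable (levyWeight (d := d)) (stableLevyMeasure α d) := by
  refine ((integrable_min_one_norm_sq h).add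
    (integrable_indicator_norm_stableLevyMeasure hα₁ hα₂)).mono'
    measurable_levyWeight.aestronglyMeasurable (Eventually.of_forall fun u => ?_)
  rw [Real.norm_of_nonneg (levyWeight_nonneg u), levyWeight, Pi.add_apply]
  rcases le_or_gt ‖u‖ 1 with hu | hu
  · rw [Set.indicator_of_notMem (by simpa using hu), min_eq_right hu,
      min_eq_right (pow_le_one₀ (norm_nonneg u) hu), add_zero, sq]
  · rw [Set.indicator_of_mem (by simpa using hu), min_eq_left hu.le, mul_one]
    exact le_add_of_nonneg_left (le_min zero_le_one (sq_nonneg _))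

/-- Scaling of the stable Lévy measure. -/
lemma integral_comp_smul_stableLevyMeasure (hα₁ : 1 < α) (hα₂ : α < 2) {s : ℝ} (hs : 0 < s)
    (g : Rd d → ℂ) :
    ∫ u, g (s • u) ∂(stableLevyMeasure α d) =
      ((s ^ α : ℝ) : ℂ) * ∫ u, g u ∂(stableLevyMeasure α d) := by
  rw [integral_stableLevyMeasure hα₁ hα₂, integral_stableLevyMeasure hα₁ hα₂]
  -- The density is homogeneous of degree `-(d + α)`; the Jacobian `s ^ (-d)` of the substitution
  -- then leaves `s ^ α`.
  have e : ∀ u : Rd d, stableDensity α d u • g (s • u) =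
      (s ^ ((d : ℝ) + α)) • (stableDensity α d (s • u) • g (s • u)) := fun u => by
    rw [smul_smul]
    congr 1
    unfold stableDensity
    rw [norm_smul, Real.norm_of_nonneg hs.le, Real.mul_rpow hs.le (norm_nonneg u)]
    have := (Real.rpow_pos_of_pos hs ((d : ℝ) + α)).ne'
    rw [mul_div_assoc', mul_div_mul_left _ _ this]
  simp only [e]
  rw [integral_smul, Measure.integral_comp_smul volume
    (fun u : Rd d => stableDensity α d u • g u) s, finrank_euclideanSpace_fin, smul_smul,
    Complex.real_smul, abs_of_pos (inv_pos.2 (pow_pos hs d)), Real.rpow_add hs, Real.rpow_natCast]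
  congr 2
  have := (pow_pos hs d).ne'
  field_simp

lemma levyExponent_smul (hα₁ : 1 < α) (hα₂ : α < 2) {s : ℝ} (hs : 0 < s) (ξ : Rd d) :
    levyExponent (stableLevyMeasure α d) (s • ξ) =
      ((s ^ α : ℝ) : ℂ) * levyExponent (stableLevyMeasure α d) ξ := by
  unfold levyExponent
  rw [← integral_comp_smul_stableLevyMeasure hα₁ hα₂ hs]
  simp only [compExp, inner_smul_right, real_inner_smul_left]

/-- Makes the moment factor in the final bound positive, so that it can be divided out. For `d ≥ 1`
points are Lebesgue-null, and the punctured unit ball, where density and integrand are positive, has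
positive volume. -/
lemma truncated_second_moment_pos (hd : 1 ≤ d) (hα₁ : 1 < α) (hα₂ : α < 2)
    (h : IsLevyMeasure (stableLevyMeasure α d)) :
    0 < ∫ u in {u : Rd d | ‖u‖ ≤ 1}, ‖u‖ ^ 2 ∂(stableLevyMeasure α d) := by
  have : Nonempty (Fin d) := ⟨⟨0, hd⟩⟩
  have hS : MeasurableSet {u : Rd d | ‖u‖ ≤ 1} := measurableSet_le measurable_norm measurable_const
  rw [setIntegral_pos_iff_support_of_nonneg_ae (Eventually.of_forall fun u => sq_nonneg _)]
  · rw [pos_iff_ne_zero]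
    intro h0
    rw [stableLevyMeasure_eq, withDensity_apply_eq_zero (measurable_stableDensity α d).ennreal_ofReal] at h0
    have hsub : Metric.ball (0 : Rd d) 1 \ {0} ⊆
        {x | ENNReal.ofReal (stableDensity α d x) ≠ 0} ∩
          ((Function.support fun u : Rd d => ‖u‖ ^ 2) ∩ {u : Rd d | ‖u‖ ≤ 1}) := by
      rintro u ⟨hu, hu0⟩
      rw [mem_ball_zero_iff] at hu
      have hu0' : u ≠ 0 := hu0
      exact ⟨(ENNReal.ofReal_pos.2 (stableDensity_pos hα₁ hα₂ hu0')).ne', by simpa using hu0',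
        hu.le⟩
    have h1 := measure_mono_null hsub h0
    rw [measure_sdiff_null (measure_singleton _)] at h1
    exact (Metric.measure_ball_pos volume (0 : Rd d) one_pos).ne' h1
  · refine ((integrable_min_one_norm_sq h).integrableOn (s := {u | ‖u‖ ≤ 1})).congr_fun
      (fun u hu => ?_) hS
    exact min_eq_right (pow_le_one₀ (norm_nonneg u) hu)

/-! ### The stable law -/

/-- The drift is exactly the compensator of the jumps larger than one, so truncated compensation
plus drift equals full compensation. -/
lemma IsStableLaw.charFun_eq {μα : Measure (Rd d)} (h : IsStableLaw α d μα) (hα₁ : 1 < α)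
    (hα₂ : α < 2) (ξ : Rd d) :
    charFun μα ξ = Complex.exp (levyExponent (stableLevyMeasure α d) ξ) := by
  obtain ⟨-, -, hL, hchar⟩ := h
  set ν := stableLevyMeasure α d
  have hν : Integrable (levyWeight (d := d)) ν := integrable_levyWeight hα₁ hα₂ hL
  have hS : MeasurableSet {u : Rd d | 1 < ‖u‖} := measurableSet_lt measurable_const measurable_norm
  have hbig : IntegrableOn (fun u : Rd d => u) {u | 1 < ‖u‖} ν := by
    refine (integrable_norm_iff aestronglyMeasurable_id).1 ?_
    exact (integrable_indicator_iff hS).1 (integrable_indicator_norm_stableLevyMeasure hα₁ hα₂)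
  have hbig' : IntegrableOn (fun u : Rd d => inner ℝ ξ u) {u | 1 < ‖u‖} ν := hbig.const_inner ξ
  have hsplit : ∀ u : Rd d, Complex.exp (Complex.I * ((inner ℝ ξ u : ℝ) : ℂ)) - 1
      - Complex.I * (((Metric.closedBall (0 : Rd d) 1).indicator
        (fun u => (inner ℝ ξ u : ℝ)) u : ℝ) : ℂ) =
      compExp ξ u + Complex.I * (({u : Rd d | 1 < ‖u‖}.indicator
        (fun u => (inner ℝ ξ u : ℝ)) u : ℝ) : ℂ) := fun u => by
    rw [compExp, real_inner_comm]
    rcases le_or_gt ‖u‖ 1 with hu | hu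
    · rw [Set.indicator_of_mem (by simpa using hu), Set.indicator_of_notMem (by simpa using hu),
        real_inner_comm, mul_comm Complex.I]
      simp
    · rw [Set.indicator_of_notMem (by simpa using hu), Set.indicator_of_mem (by simpa using hu),
        real_inner_comm, mul_comm Complex.I]
      simp [mul_comm]
  rw [hchar ξ]
  congr 1
  have hbig'' : Integrable (fun u => Complex.I * (({u : Rd d | 1 < ‖u‖}.indicator
      (fun u => (inner ℝ ξ u : ℝ)) u : ℝ) : ℂ)) ν :=
    ((integrable_indicator_iff hS).2 hbig').ofReal.const_mul _
  rw [integral_congr_ae (Eventually.of_forall hsplit),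
    integral_add (integrable_compExp hν ξ) hbig'', integral_const_mul,
    integral_complex_ofReal, integral_indicator hS, integral_inner hbig, inner_neg_left,
    real_inner_comm]
  simp [levyExponent]

lemma integrable_norm_of_rpow {μ : Measure (Rd d)} [IsFiniteMeasure μ] {β : ℝ} (hβ : 1 ≤ β)
    (h : Integrable (fun x => ‖x‖ ^ β) μ) : Integrable (fun x => ‖x‖) μ := by
  refine ((integrable_const (1 : ℝ)).add h).mono' measurable_norm.aestronglyMeasurable
    (Eventually.of_forall fun x => ?_)
  rw [norm_norm, Pi.add_apply]
  have h0 : 0 ≤ ‖x‖ ^ β := by positivity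
  rcases le_total ‖x‖ 1 with hx | hx
  · linarith
  · have := Real.self_le_rpow_of_one_le hx hβ
    linarith

/-- For an exponent in `[0, 1]`, `U ^ p` lies between `1` and `U`. -/
lemma abs_rpow_sub_one_le {U p : ℝ} (hU : 0 < U) (hp0 : 0 ≤ p) (hp1 : p ≤ 1) :
    |U ^ p - 1| ≤ |U - 1| := by
  rcases le_total U 1 with h | h
  · have h1 := Real.rpow_le_one hU.le h hp0
    have h2 := Real.self_le_rpow_of_le_one hU.le h hp1
    rw [abs_of_nonpos (by linarith), abs_of_nonpos (by linarith)]
    linarith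
  · have h1 := Real.one_le_rpow h hp0
    have h2 := Real.rpow_le_self_of_one_le h hp1
    rw [abs_of_nonneg (by linarith), abs_of_nonneg (by linarith)]
    linarith

/-- A probability measure satisfying the Poincaré inequality and the Weyl condition is a dilation
of the stable law. -/
lemma IsStableLaw.eq_map_smul {μα μ : Measure (Rd d)} (h : IsStableLaw α d μα) (hα₁ : 1 < α)
    (hα₂ : α < 2) [IsProbabilityMeasure μ] (hμ : Integrable (fun x => ‖x‖) μ)
    (hμ0 : ∫ x, x ∂μ = 0) {U : ℝ} (hU0 : 0 < U)
    (hU : NonlocalPoincare (stableLevyMeasure α d) μ U)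
    (hW : WeylCondition (stableLevyMeasure α d) μ U) :
    μ = μα.map (fun x => U ^ α⁻¹ • x) := by
  have : IsProbabilityMeasure μα := h.1
  have : IsProbabilityMeasure (μα.map fun x => U ^ α⁻¹ • x) :=
    Measure.isProbabilityMeasure_map (by fun_prop)
  have hid : Integrable (fun x : Rd d => x) μ := (integrable_norm_iff aestronglyMeasurable_id).1 hμ
  have hcoord : ∀ j : Fin d, ∫ x, x j ∂μ = 0 := fun j => by
    have := (EuclideanSpace.proj j : Rd d →L[ℝ] ℝ).integral_comp_comm hid
    simpa [hμ0] using this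
  refine Measure.ext_of_charFun (funext fun ξ => ?_)
  rw [charFun_map_smul, h.charFun_eq hα₁ hα₂, levyExponent_smul hα₁ hα₂ (Real.rpow_pos_of_pos hU0 _),
    Real.rpow_inv_rpow hU0.le (by linarith)]
  exact charFun_eq_exp_levyExponent hU hW (integrable_levyWeight hα₁ hα₂ h.2.2.1) hμ hcoord ξ

lemma IsStableLaw.unique {μ₁ μ₂ : Measure (Rd d)} (h₁ : IsStableLaw α d μ₁)
    (h₂ : IsStableLaw α d μ₂) : μ₁ = μ₂ := by
  have : IsProbabilityMeasure μ₁ := h₁.1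
  have : IsProbabilityMeasure μ₂ := h₂.1
  exact Measure.ext_of_charFun (funext fun ξ => (h₁.2.2.2 ξ).trans (h₂.2.2.2 ξ).symm)

/-! ### Wasserstein distance under dilation -/

lemma abs_sub_le_of_mem_smoothTestClass {h : Rd d → ℝ} (hh : h ∈ smoothTestClass d 1)
    (x y : Rd d) : |h x - h y| ≤ ‖x - y‖ := by
  have := (convex_univ : Convex ℝ (Set.univ : Set (Rd d))).norm_image_sub_le_of_norm_fderiv_le (𝕜 := ℝ) (f := h) (C := 1)
    (fun z _ => (hh.1.differentiable (by norm_num)) z)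
    (fun z _ => by simpa only [norm_iteratedFDeriv_one] using hh.2 1 le_rfl z)
    (Set.mem_univ y) (Set.mem_univ x)
  simpa using this

/-- The smooth Wasserstein distance between a law and its dilation. -/
lemma smoothWasserstein_map_smul_le {μ : Measure (Rd d)} [IsProbabilityMeasure μ]
    (hμ : Integrable (fun x => ‖x‖) μ) (s : ℝ) :
    smoothWasserstein 1 (μ.map fun x => s • x) μ ≤ |s - 1| * ∫ x, ‖x‖ ∂μ := by
  refine Real.sSup_le ?_ (by positivity)
  rintro t ⟨h, hh, rfl⟩
  have hc : Continuous h := hh.1.continuous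
  have hb : ∀ x, ‖h x‖ ≤ 1 := fun x => by
    simpa only [norm_iteratedFDeriv_zero] using hh.2 0 zero_le_one x
  rw [integral_map (by fun_prop) hc.aestronglyMeasurable, ← integral_sub
    (Integrable.of_bound (by fun_prop) 1 (Eventually.of_forall fun x => hb _))
    (Integrable.of_bound hc.aestronglyMeasurable 1 (Eventually.of_forall hb)),
    ← integral_const_mul]
  refine norm_integral_le_of_norm_le (f := fun x => h (s • x) - h x) (hμ.const_mul _)
    (Eventually.of_forall fun x => ?_)
  refine (abs_sub_le_of_mem_smoothTestClass hh _ _).trans (le_of_eq ?_)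
  rw [show s • x - x = (s - 1) • x by rw [sub_smul, one_smul], norm_smul, Real.norm_eq_abs]

/-- The first moment of the stable law is finite if some dilation of it has finite first moment. -/
lemma integrable_norm_of_map_smul {μ : Measure (Rd d)} {s : ℝ} (hs : s ≠ 0)
    (h : Integrable (fun x => ‖x‖) (μ.map fun x => s • x)) : Integrable (fun x => ‖x‖) μ := by
  rw [integrable_map_measure (by fun_prop) (by fun_prop)] at h
  refine (h.const_mul |s|⁻¹).congr (Eventually.of_forall fun x => ?_)
  have := abs_ne_zero.2 hs
  simp only [Function.comp_apply, norm_smul, Real.norm_eq_abs]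
  field_simp

end StableStability

theorem mainTheorem11 (d : ℕ) (hd : 1 ≤ d) (α : ℝ) (hα₁ : 1 < α) (hα₂ : α < 2) :
    ∃ C : ℝ, 0 < C ∧
      ∀ μα : Measure (StableStability.Rd d), StableStability.IsStableLaw α d μα →
      ∀ β : ℝ, 1 < β → β < α →
      ∀ μ : Measure (StableStability.Rd d), IsProbabilityMeasure μ →
        Integrable (fun x => ‖x‖ ^ β) μ →
        ∫ x, x ∂μ = 0 →
        Measure.conv μ (StableStability.stableLevyMeasure α d) ≪ μ →
      ∀ U : ℝ, 0 < U →
        StableStability.NonlocalPoincare (StableStability.stableLevyMeasure α d) μ U →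
        StableStability.WeylCondition (StableStability.stableLevyMeasure α d) μ U →
        StableStability.smoothWasserstein 1 μ μα ≤
          C * ((∫ u in {u : StableStability.Rd d | ‖u‖ ≤ 1},
                  ‖u‖ ^ 2 ∂(StableStability.stableLevyMeasure α d))
              + ∫ u in {u : StableStability.Rd d | 1 ≤ ‖u‖},
                  ‖u‖ ∂(StableStability.stableLevyMeasure α d)) * |U - 1| := by
  -- The constant is built from the first moment of a stable law, fixed once as `μ₀`; by uniqueness
  -- it depends only on `α` and `d`. If no such law existed, any constant would do.
  by_cases hex : ∃ μα : Measure (StableStability.Rd d), StableStability.IsStableLaw α d μα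
  swap
  · exact ⟨1, one_pos, fun μα hμα => (hex ⟨μα, hμα⟩).elim⟩
  obtain ⟨μ₀, hμ₀⟩ := hex
  set M := (∫ u in {u : StableStability.Rd d | ‖u‖ ≤ 1},
      ‖u‖ ^ 2 ∂(StableStability.stableLevyMeasure α d))
    + ∫ u in {u : StableStability.Rd d | 1 ≤ ‖u‖},
      ‖u‖ ∂(StableStability.stableLevyMeasure α d)
  have hM : 0 < M := add_pos_of_pos_of_nonneg
    (StableStability.truncated_second_moment_pos hd hα₁ hα₂ hμ₀.2.2.1)
    (integral_nonneg fun u => norm_nonneg u)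
  have hm : 0 ≤ ∫ x, ‖x‖ ∂μ₀ := integral_nonneg fun x => norm_nonneg x
  -- Dividing by `M` cancels the moment factor of the bound; the `+ 1` secures positivity, even if
  -- the integral took its default value zero.
  refine ⟨(∫ x, ‖x‖ ∂μ₀ + 1) / M, by positivity, ?_⟩
  intro μα hμα β hβ _ μ hμ hβμ hmean _ U hU hP hW
  obtain rfl := hμ₀.unique hμα
  have : IsProbabilityMeasure μ₀ := hμ₀.1
  have hμ1 := StableStability.integrable_norm_of_rpow hβ.le hβμ
  have hmap := hμ₀.eq_map_smul hα₁ hα₂ hμ1 hmean hU hP hW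
  -- The first moment of `μ₀` is finite because `μ` is a dilation of `μ₀` and has a finite first
  -- moment.
  have hint : Integrable (fun x => ‖x‖) μ₀ :=
    StableStability.integrable_norm_of_map_smul (Real.rpow_pos_of_pos hU α⁻¹).ne' (hmap ▸ hμ1)
  rw [div_mul_cancel₀ _ hM.ne', hmap]
  refine (StableStability.smoothWasserstein_map_smul_le hint _).trans ?_
  have h1 : |U ^ α⁻¹ - 1| ≤ |U - 1| := StableStability.abs_rpow_sub_one_le hU (by positivity)
    (inv_le_one_of_one_le₀ hα₁.le)
  nlinarith [mul_le_mul_of_nonneg_right h1 hm, abs_nonneg (U - 1)]
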